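/- Let $n\ge 1$ be an integer, $\beta>0$ real, and let $\theta_1,\dots,\theta_n$ be real random variables on a probability space whose joint law is the circular $\beta$-ensemble, i.e. has on $[0,2\pi)^n$ the density $$f(\theta_1,\dots,\theta_n\mid\beta)=(2\pi)^{-n}\,\frac{\Gamma(1+\beta/2)^n}{\Gamma(1+\beta n/2)}\prod_{1\le j<k\le n}\bigl|e^{i\theta_j}-e^{i\theta_k}\bigr|^{\beta}$$ with respect to Lebesgue measure. Put $Z_n=(e^{i\theta_1},\dots,e^{i\theta_n})$ and $p_1(z_1,\dots,z_n)=z_1+\cdots+z_n$. Then $$\mathbb E\bigl[|p_1(Z_n)|^2\bigr]=\frac{2}{\beta}\cdot\frac{n}{n-1+2/\beta}.$$ In particular, this expectation equals $\frac{2n}{n+1}$ if $\beta=1$ (the COE), $1$ if $\beta=2$ (the CUE), and $\frac{n}{2n-1}$ if $\beta=4$ (the CSE). -/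

import Mathlib

open MeasureTheory ProbabilityTheory
open scoped ENNReal

noncomputable section

/-- The point `(e^{i t_1}, …, e^{i t_n})` of the torus attached to a vector of angles. -/
def torusPoint {n : ℕ} (t : Fin n → ℝ) : Fin n → ℂ :=
  fun j => Complex.exp (Complex.I * (t j : ℂ))

/-- The circular `β`-ensemble density
`(2π)^{-n} Γ(1+β/2)^n / Γ(1+βn/2) ∏_{j<k} |e^{i t_j} - e^{i t_k}|^β`. -/
def circularBetaDensity (n : ℕ) (β : ℝ) (t : Fin n → ℝ) : ℝ :=
  ((2 * Real.pi) ^ n)⁻¹ * (Real.Gamma (1 + β / 2) ^ n / Real.Gamma (1 + β * n / 2)) *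
    ∏ j : Fin n, ∏ k ∈ Finset.Ioi j, ‖torusPoint t j - torusPoint t k‖ ^ β

/-- The measure on `ℝⁿ` which is carried by `[0, 2π)ⁿ` and has there the circular `β`-ensemble
density with respect to Lebesgue measure. -/
def circularBetaEnsemble (n : ℕ) (β : ℝ) : Measure (Fin n → ℝ) :=
  ((volume : Measure (Fin n → ℝ)).restrict
      (Set.univ.pi fun _ => Set.Ico (0 : ℝ) (2 * Real.pi))).withDensity
    fun t => ENNReal.ofReal (circularBetaDensity n β t)

/-- The power sum `p_k(z_1, …, z_n) = z_1^k + ⋯ + z_n^k`. -/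
def powerSum {n : ℕ} (k : ℕ) (z : Fin n → ℂ) : ℂ :=
  MvPolynomial.eval z (MvPolynomial.psum (Fin n) ℂ k)

end

open Finset Filter Topology

/-! The proof is one integration by parts on the torus. Let `p` be the sum of the `z_i`, let `w` be
the weight, and take the field `F_i = Im (z_i * conj p)`. Its divergence is `|p|² - n`. Pairing `F`
with the gradient of `log w` gives `β/2` times the sum over pairs of `Re ((z_j + z_k) * conj p)`,
which is `β/2 * (n - 1) * |p|²` (`sinField_sub_mul_sin`, `sum_pairTerm`). By periodicity the
divergence of `w F` has integral zero, so `(1 + β/2 * (n - 1)) * E|p|² = n`.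

For small `β` the weight is not differentiable where two angles collide. The divergence theorem is
therefore applied with `ε > 0`, and `ε → 0` is taken by dominated convergence. The Gamma factors are
never evaluated: the law is given as a probability measure. -/

/-- The circular weight `∏_{j<k} (ε + |e^{i t_j} - e^{i t_k}|²)^{β/2}`, regularized by `ε`. -/
noncomputable def regularizedWeight {n : ℕ} (β ε : ℝ) (t : Fin n → ℝ) : ℝ :=
  ∏ j, ∏ k ∈ Ioi j, (ε + (2 - 2 * Real.cos (t j - t k))) ^ (β / 2)

/-- The squared modulus of `e^{i t_1} + ⋯ + e^{i t_n}`, in terms of differences of angles. -/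
noncomputable def cosSum {n : ℕ} (t : Fin n → ℝ) : ℝ :=
  ∑ i, ∑ k, Real.cos (t i - t k)

/-- The real part of `(z_j + z_k) * conj (z_1 + ⋯ + z_n)` for `z = e^{i t}`. -/
noncomputable def pairTerm {n : ℕ} (t : Fin n → ℝ) (j k : Fin n) : ℝ :=
  (∑ l, Real.cos (t l)) * (Real.cos (t j) + Real.cos (t k)) +
    (∑ l, Real.sin (t l)) * (Real.sin (t j) + Real.sin (t k))

/-- The divergence of the vector field `t ↦ (Im (z_i * conj (z_1 + ⋯ + z_n)))_i` with respect to
the regularized weight. -/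
noncomputable def weightedDivergence {n : ℕ} (β ε : ℝ) (t : Fin n → ℝ) : ℝ :=
  (cosSum t - n) + β / 2 * ∑ j, ∑ k ∈ Ioi j,
    (2 - 2 * Real.cos (t j - t k)) / (ε + (2 - 2 * Real.cos (t j - t k))) * pairTerm t j k

/-! ### Trigonometric identities and the density -/

lemma two_sub_two_cos_nonneg (x : ℝ) : 0 ≤ 2 - 2 * Real.cos x := by
  linarith [Real.cos_le_one x]

lemma cosSum_eq {n : ℕ} (t : Fin n → ℝ) :
    cosSum t = (∑ l, Real.cos (t l)) ^ 2 + (∑ l, Real.sin (t l)) ^ 2 := by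
  simp only [cosSum, Real.cos_sub, sum_add_distrib, sq, sum_mul_sum]

/-- Each index lies in exactly `n - 1` pairs. -/
lemma sum_pairTerm {n : ℕ} (t : Fin n → ℝ) :
    ∑ j, ∑ k ∈ Ioi j, pairTerm t j k = ((n : ℝ) - 1) * cosSum t := by
  set C := ∑ l, Real.cos (t l) with hC
  set S := ∑ l, Real.sin (t l) with hS
  have h := sum_sum_Ioi_add_eq_sum_sum_off_diag
    (fun j _ : Fin n => C * Real.cos (t j) + S * Real.sin (t j))
  have h₁ : ∀ j k, pairTerm t j k = (C * Real.cos (t k) + S * Real.sin (t k)) +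
      (C * Real.cos (t j) + S * Real.sin (t j)) := fun j k => by
    simp only [pairTerm, ← hC, ← hS]; ring
  simp only [h₁]
  rw [h, cosSum_eq, ← hC, ← hS]
  have h₂ : ∀ i : Fin n, ∑ j ∈ {i}ᶜ, (C * Real.cos (t j) + S * Real.sin (t j)) =
      (C * C + S * S) - (C * Real.cos (t i) + S * Real.sin (t i)) := fun i => by
    rw [eq_sub_iff_add_eq, add_comm, ← Fintype.sum_eq_add_sum_compl i
      fun j => C * Real.cos (t j) + S * Real.sin (t j), sum_add_distrib, ← mul_sum, ← mul_sum]
  simp only [h₂, sum_sub_distrib, sum_add_distrib, ← mul_sum, ← hC, ← hS]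
  simp
  ring

lemma norm_sq_powerSum_one {n : ℕ} (t : Fin n → ℝ) :
    ‖powerSum 1 (torusPoint t)‖ ^ 2 = cosSum t := by
  have h : powerSum 1 (torusPoint t) =
      ((∑ l, Real.cos (t l) : ℝ) : ℂ) + ((∑ l, Real.sin (t l) : ℝ) : ℂ) * Complex.I := by
    simp [powerSum, torusPoint, MvPolynomial.psum, mul_comm Complex.I, Complex.exp_mul_I,
      sum_add_distrib, sum_mul]
  rw [h, Complex.sq_norm, Complex.normSq_add_mul_I, cosSum_eq]

lemma norm_sq_torusPoint_sub {n : ℕ} (t : Fin n → ℝ) (j k : Fin n) :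
    ‖torusPoint t j - torusPoint t k‖ ^ 2 = 2 - 2 * Real.cos (t j - t k) := by
  have h : torusPoint t j - torusPoint t k = ((Real.cos (t j) - Real.cos (t k) : ℝ) : ℂ) +
      ((Real.sin (t j) - Real.sin (t k) : ℝ) : ℂ) * Complex.I := by
    simp [torusPoint, mul_comm Complex.I, Complex.exp_mul_I]
    ring
  rw [h, Complex.sq_norm, Complex.normSq_add_mul_I, Real.cos_sub]
  linear_combination Real.cos_sq_add_sin_sq (t j) + Real.cos_sq_add_sin_sq (t k)

lemma circularBetaDensity_eq {n : ℕ} (β : ℝ) (t : Fin n → ℝ) :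
    circularBetaDensity n β t = ((2 * Real.pi) ^ n)⁻¹ *
      (Real.Gamma (1 + β / 2) ^ n / Real.Gamma (1 + β * n / 2)) * regularizedWeight β 0 t := by
  rw [circularBetaDensity, regularizedWeight]
  congr 1
  refine prod_congr rfl fun j _ => prod_congr rfl fun k _ => ?_
  rw [zero_add, ← norm_sq_torusPoint_sub, ← Real.rpow_natCast, ← Real.rpow_mul (norm_nonneg _)]
  congr 1
  push_cast
  ring

/-! ### Positivity, monotonicity and continuity -/

lemma regularizedWeight_nonneg {n : ℕ} (β : ℝ) {ε : ℝ} (hε : 0 ≤ ε) (t : Fin n → ℝ) :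
    0 ≤ regularizedWeight β ε t :=
  prod_nonneg fun _ _ => prod_nonneg fun _ _ =>
    Real.rpow_nonneg (add_nonneg hε (two_sub_two_cos_nonneg _)) _

lemma regularizedWeight_mono {n : ℕ} {β : ℝ} (hβ : 0 ≤ β) {ε δ : ℝ} (hε : 0 ≤ ε) (h : ε ≤ δ)
    (t : Fin n → ℝ) : regularizedWeight β ε t ≤ regularizedWeight β δ t := by
  have h₀ : ∀ j k, 0 ≤ ε + (2 - 2 * Real.cos (t j - t k)) := fun j k =>
    add_nonneg hε (two_sub_two_cos_nonneg _)
  unfold regularizedWeight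
  refine prod_le_prod (fun j _ => prod_nonneg fun k _ => Real.rpow_nonneg (h₀ j k) _)
    fun j _ => prod_le_prod (fun k _ => Real.rpow_nonneg (h₀ j k) _) fun k _ => ?_
  exact Real.rpow_le_rpow (h₀ j k) (by linarith) (by linarith)

lemma continuous_regularizedWeight {n : ℕ} {β : ℝ} (hβ : 0 ≤ β) (ε : ℝ) :
    Continuous (regularizedWeight β ε : (Fin n → ℝ) → ℝ) := by
  unfold regularizedWeight
  refine continuous_finsetProd _ fun j _ => continuous_finsetProd _ fun k _ => ?_
  exact Continuous.rpow_const (by fun_prop) fun _ => Or.inr (by linarith)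

lemma continuous_regularizedWeight_param {n : ℕ} {β : ℝ} (hβ : 0 ≤ β) (t : Fin n → ℝ) :
    Continuous fun ε => regularizedWeight β ε t := by
  unfold regularizedWeight
  refine continuous_finsetProd _ fun j _ => continuous_finsetProd _ fun k _ => ?_
  exact Continuous.rpow_const (by fun_prop) fun _ => Or.inr (by linarith)

lemma regularizedWeight_zero_eq_zero {n : ℕ} {β : ℝ} (hβ : 0 < β) {t : Fin n → ℝ} {j k : Fin n}
    (hjk : k ∈ Ioi j) (h : 2 - 2 * Real.cos (t j - t k) = 0) : regularizedWeight β 0 t = 0 :=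
  prod_eq_zero (mem_univ j) <| prod_eq_zero hjk <| by
    rw [h, add_zero, Real.zero_rpow (by linarith)]

lemma continuous_cosSum {n : ℕ} : Continuous (cosSum : (Fin n → ℝ) → ℝ) := by
  unfold cosSum; fun_prop

lemma continuous_pairTerm {n : ℕ} (j k : Fin n) :
    Continuous fun t : Fin n → ℝ => pairTerm t j k := by
  unfold pairTerm; fun_prop

lemma continuous_weightedDivergence {n : ℕ} (β : ℝ) {ε : ℝ} (hε : 0 < ε) :
    Continuous (weightedDivergence β ε : (Fin n → ℝ) → ℝ) := by
  unfold weightedDivergence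
  refine (continuous_cosSum.sub continuous_const).add (continuous_const.mul ?_)
  refine continuous_finsetSum _ fun j _ => continuous_finsetSum _ fun k _ => ?_
  refine Continuous.mul (Continuous.div (by fun_prop) (by fun_prop) fun t => ?_)
    (continuous_pairTerm j k)
  exact (add_pos_of_pos_of_nonneg hε (two_sub_two_cos_nonneg _)).ne'

/-! ### The vector field and its weighted divergence -/

/-- The vector field `Im (z_i * conj (z_1 + ⋯ + z_n))`. -/
noncomputable def sinField {n : ℕ} (i : Fin n) (t : Fin n → ℝ) : ℝ :=
  ∑ k, Real.sin (t i - t k)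

lemma hasFDerivAt_sinField {n : ℕ} (i : Fin n) (t : Fin n → ℝ) :
    HasFDerivAt (sinField i) (∑ k, Real.cos (t i - t k) •
      (ContinuousLinearMap.proj (R := ℝ) (φ := fun _ : Fin n => ℝ) i -
        ContinuousLinearMap.proj k)) t := by
  unfold sinField
  exact HasFDerivAt.fun_sum fun k _ => ((hasFDerivAt_apply i t).sub (hasFDerivAt_apply k t)).sin

/-- The logarithmic derivative of the regularized weight. -/
noncomputable def logDerivWeight {n : ℕ} (β ε : ℝ) (t : Fin n → ℝ) : (Fin n → ℝ) →L[ℝ] ℝ :=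
  ∑ j, ∑ k ∈ Ioi j, (β * Real.sin (t j - t k) / (ε + (2 - 2 * Real.cos (t j - t k)))) •
    (ContinuousLinearMap.proj (R := ℝ) (φ := fun _ : Fin n => ℝ) j -
      ContinuousLinearMap.proj k)

lemma hasFDerivAt_regularizedWeight {n : ℕ} (β : ℝ) {ε : ℝ} (hε : 0 < ε) (t : Fin n → ℝ) :
    HasFDerivAt (regularizedWeight β ε) (regularizedWeight β ε t • logDerivWeight β ε t) t := by
  have hpos : ∀ (t : Fin n → ℝ) j k, 0 < ε + (2 - 2 * Real.cos (t j - t k)) := fun t j k =>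
    add_pos_of_pos_of_nonneg hε (two_sub_two_cos_nonneg _)
  -- For `ε > 0` every factor is positive, so the weight is the exponential of a sum of logarithms.
  have hexp : (regularizedWeight β ε : (Fin n → ℝ) → ℝ) = fun t =>
      Real.exp (∑ j, ∑ k ∈ Ioi j,
        Real.log (ε + (2 - 2 * Real.cos (t j - t k))) * (β / 2)) := by
    funext t
    simp only [regularizedWeight, Real.exp_sum, Real.rpow_def_of_pos (hpos t _ _)]
  have hlog : HasFDerivAt (fun t : Fin n → ℝ => ∑ j, ∑ k ∈ Ioi j,
        Real.log (ε + (2 - 2 * Real.cos (t j - t k))) * (β / 2)) (logDerivWeight β ε t) t := by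
    unfold logDerivWeight
    refine HasFDerivAt.fun_sum fun j _ => HasFDerivAt.fun_sum fun k _ => ?_
    have h := ((((((hasFDerivAt_apply (𝕜 := ℝ) j t).sub
      (hasFDerivAt_apply (𝕜 := ℝ) k t)).cos.const_mul 2).const_sub 2).const_add ε).log
        (hpos t j k).ne').mul_const (β / 2)
    refine h.congr_fderiv ?_
    ext v
    simp
    ring
  have h := hlog.exp
  rw [hexp]
  exact h

/-- The key cancellation: the factor `|z_j - z_k|²` comes out and absorbs the pole of the
logarithmic derivative at a collision. -/
lemma sinField_sub_mul_sin {n : ℕ} (t : Fin n → ℝ) (j k : Fin n) :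
    2 * (Real.sin (t j - t k) * (sinField j t - sinField k t)) =
      (2 - 2 * Real.cos (t j - t k)) * pairTerm t j k := by
  have h : ∀ i, sinField i t =
      Real.sin (t i) * ∑ l, Real.cos (t l) - Real.cos (t i) * ∑ l, Real.sin (t l) := fun i => by
    simp only [sinField, Real.sin_sub, sum_sub_distrib, mul_sum]
  rw [h, h, pairTerm, Real.sin_sub, Real.cos_sub]
  have hj := Real.sin_sq_add_cos_sq (t j)
  have hk := Real.sin_sq_add_cos_sq (t k)
  set C := ∑ l, Real.cos (t l)
  set S := ∑ l, Real.sin (t l)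
  linear_combination (2 * C * Real.cos (t k) + 2 * S * Real.sin (t k)) * hj +
    (2 * C * Real.cos (t j) + 2 * S * Real.sin (t j)) * hk

lemma sum_fderiv_sinField_mul_weight {n : ℕ} (β : ℝ) {ε : ℝ} (t : Fin n → ℝ) :
    ∑ i, (sinField i t • (regularizedWeight β ε t • logDerivWeight β ε t) +
      regularizedWeight β ε t • ∑ k, Real.cos (t i - t k) •
      (ContinuousLinearMap.proj (R := ℝ) (φ := fun _ : Fin n => ℝ) i -
        ContinuousLinearMap.proj k)) (Pi.single i 1) =
      weightedDivergence β ε t * regularizedWeight β ε t := by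
  -- By linearity, this is the logarithmic derivative in the direction of the field.
  have h₁ : ∑ i, sinField i t * logDerivWeight β ε t (Pi.single i 1) =
      logDerivWeight β ε t fun i => sinField i t := by
    conv_rhs => rw [pi_eq_sum_univ' fun i => sinField i t, map_sum]
    refine sum_congr rfl fun i _ => ?_
    rw [← smul_eq_mul, ← map_smul]
  have h₂ : logDerivWeight β ε t (fun i => sinField i t) = β / 2 * ∑ j, ∑ k ∈ Ioi j,
      (2 - 2 * Real.cos (t j - t k)) / (ε + (2 - 2 * Real.cos (t j - t k))) * pairTerm t j k := by
    simp only [logDerivWeight, _root_.sum_apply, mul_sum]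
    refine sum_congr rfl fun j _ => sum_congr rfl fun k _ => ?_
    have h := sinField_sub_mul_sin t j k
    simp only [smul_apply, sub_apply,
      ContinuousLinearMap.proj_apply, smul_eq_mul]
    rw [div_mul_eq_mul_div, div_mul_eq_mul_div _ _ (pairTerm t j k), ← h]
    ring
  have h₃ : ∀ i, (∑ k, Real.cos (t i - t k) •
      (ContinuousLinearMap.proj (R := ℝ) (φ := fun _ : Fin n => ℝ) i -
        ContinuousLinearMap.proj k) : (Fin n → ℝ) →L[ℝ] ℝ) (Pi.single i 1) = ∑ k, Real.cos (t i - t k) - 1 := fun i => by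
    simp [_root_.sum_apply, mul_sub, sum_sub_distrib, Pi.single_apply]
  simp only [add_apply, smul_apply, h₃, smul_eq_mul,
    sum_add_distrib, ← mul_sum, sum_sub_distrib]
  have h₄ : ∑ i, sinField i t * (regularizedWeight β ε t * logDerivWeight β ε t (Pi.single i 1)) =
      regularizedWeight β ε t * ∑ i, sinField i t * logDerivWeight β ε t (Pi.single i 1) := by
    rw [mul_sum]
    exact sum_congr rfl fun i _ => by ring
  rw [h₄, weightedDivergence, ← h₂, ← h₁, cosSum]
  simp
  ring

/-! ### Divergence theorem on the periodic box -/

lemma cos_insertNth_sub {m : ℕ} (i : Fin (m + 1)) (x : Fin m → ℝ) (j k : Fin (m + 1)) :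
    Real.cos (i.insertNth (α := fun _ => ℝ) (2 * Real.pi) x j -
        i.insertNth (α := fun _ => ℝ) (2 * Real.pi) x k) =
      Real.cos (i.insertNth (α := fun _ => ℝ) 0 x j - i.insertNth (α := fun _ => ℝ) 0 x k) := by
  rcases Fin.eq_self_or_eq_succAbove i j with hj | ⟨j, rfl⟩ <;>
  rcases Fin.eq_self_or_eq_succAbove i k with hk | ⟨k, rfl⟩ <;>
  simp [Real.cos_two_pi_sub, Real.cos_sub_two_pi, *]

lemma sin_insertNth_sub {m : ℕ} (i : Fin (m + 1)) (x : Fin m → ℝ) (k : Fin (m + 1)) :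
    Real.sin (i.insertNth (α := fun _ => ℝ) (2 * Real.pi) x i -
        i.insertNth (α := fun _ => ℝ) (2 * Real.pi) x k) =
      Real.sin (i.insertNth (α := fun _ => ℝ) 0 x i - i.insertNth (α := fun _ => ℝ) 0 x k) := by
  rcases Fin.eq_self_or_eq_succAbove i k with rfl | ⟨k, rfl⟩ <;>
  simp [Real.sin_two_pi_sub]

/-- Field and weight are `2π`-periodic in each angle, so the fluxes through opposite faces cancel.
-/
lemma integral_weightedDivergence_mul_weight {m : ℕ} {β ε : ℝ} (hβ : 0 ≤ β) (hε : 0 < ε) :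
    ∫ t in Set.Icc (0 : Fin (m + 1) → ℝ) (fun _ => 2 * Real.pi),
      weightedDivergence β ε t * regularizedWeight β ε t = 0 := by
  have hd : ∀ (t : Fin (m + 1) → ℝ) i,
      HasFDerivAt (fun t => sinField i t * regularizedWeight β ε t) _ t := fun t i =>
    (hasFDerivAt_sinField i t).mul (hasFDerivAt_regularizedWeight β hε t)
  have h := integral_divergence_of_hasFDerivAt_off_countable'
    (0 : Fin (m + 1) → ℝ) (fun _ => 2 * Real.pi) (fun _ => Real.two_pi_pos.le)
    (fun i t => sinField i t * regularizedWeight β ε t) _ ∅ Set.countable_empty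
    (fun i t _ => (hd t i).continuousAt.continuousWithinAt) (fun t _ i => hd t i)
    (by
      simp only [sum_fderiv_sinField_mul_weight]
      exact ((continuous_weightedDivergence β hε).mul
        (continuous_regularizedWeight hβ ε)).continuousOn.integrableOn_compact isCompact_Icc)
  simp only [sum_fderiv_sinField_mul_weight] at h
  rw [h]
  refine sum_eq_zero fun i _ => ?_
  rw [sub_eq_zero]
  simp only [sinField, regularizedWeight, Pi.zero_apply, cos_insertNth_sub, sin_insertNth_sub]

/-! ### Removing the regularization -/

lemma tendsto_weightedDivergence_mul_weight {n : ℕ} {β : ℝ} (hβ : 0 < β) (t : Fin n → ℝ) :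
    Tendsto (fun ε => weightedDivergence β ε t * regularizedWeight β ε t) (𝓝[>] 0)
      (𝓝 ((cosSum t - n + β / 2 * (((n : ℝ) - 1) * cosSum t)) * regularizedWeight β 0 t)) := by
  have hw : Tendsto (fun ε => regularizedWeight β ε t) (𝓝[>] 0) (𝓝 (regularizedWeight β 0 t)) :=
    ((continuous_regularizedWeight_param hβ.le t).tendsto 0).mono_left nhdsWithin_le_nhds
  have hr : ∀ j, ∀ k ∈ Ioi j, Tendsto (fun ε => (2 - 2 * Real.cos (t j - t k)) /
      (ε + (2 - 2 * Real.cos (t j - t k))) * pairTerm t j k * regularizedWeight β ε t)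
      (𝓝[>] 0) (𝓝 (pairTerm t j k * regularizedWeight β 0 t)) := fun j k hk => by
    -- At a collision the ratio is `0` for every `ε`, not close to `1`, but there the limiting
    -- weight vanishes because `β > 0`.
    by_cases h : 2 - 2 * Real.cos (t j - t k) = 0
    · rw [regularizedWeight_zero_eq_zero hβ hk h]
      simp [h]
    · have h₁ : Tendsto (fun ε => (2 - 2 * Real.cos (t j - t k)) /
          (ε + (2 - 2 * Real.cos (t j - t k)))) (𝓝[>] 0) (𝓝 1) := by
        have : ContinuousAt (fun ε => (2 - 2 * Real.cos (t j - t k)) /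
            (ε + (2 - 2 * Real.cos (t j - t k)))) 0 :=
          ContinuousAt.div (by fun_prop) (by fun_prop) (by simpa using h)
        simpa [div_self h] using this.tendsto.mono_left nhdsWithin_le_nhds
      simpa using (h₁.mul_const (pairTerm t j k)).mul hw
  have h := (hw.const_mul (cosSum t - n)).add
    ((tendsto_finsetSum univ fun j _ => tendsto_finsetSum (Ioi j) fun k hk =>
      hr j k hk).const_mul (β / 2))
  refine (h.congr fun ε => ?_).trans_eq ?_
  · simp only [weightedDivergence, ← sum_mul]
    ring
  · simp only [← sum_mul, sum_pairTerm]
    ring_nf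

/-- The ratios lie in `[0, 1]`, so the bound is uniform in `ε`; with the weight at `ε = 1` it gives
the dominating function. -/
lemma abs_weightedDivergence_le {n : ℕ} {β ε : ℝ} (hβ : 0 ≤ β) (hε : 0 < ε) (t : Fin n → ℝ) :
    |weightedDivergence β ε t| ≤
      |cosSum t - n| + β / 2 * ∑ j, ∑ k ∈ Ioi j, |pairTerm t j k| := by
  refine (abs_add_le _ _).trans (add_le_add le_rfl ?_)
  rw [abs_mul, abs_of_nonneg (by linarith : 0 ≤ β / 2)]
  refine mul_le_mul_of_nonneg_left ?_ (by linarith)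
  refine (abs_sum_le_sum_abs _ _).trans (sum_le_sum fun j _ => ?_)
  refine (abs_sum_le_sum_abs _ _).trans (sum_le_sum fun k _ => ?_)
  have hu := two_sub_two_cos_nonneg (t j - t k)
  rw [abs_mul, abs_of_nonneg (by positivity)]
  exact mul_le_of_le_one_left (abs_nonneg _) (div_le_one_of_le₀ (by linarith) (by linarith))

lemma integral_cosSum_mul_weight_aux {m : ℕ} {β : ℝ} (hβ : 0 < β) :
    ∫ t in Set.Icc (0 : Fin (m + 1) → ℝ) (fun _ => 2 * Real.pi),
      (cosSum t - (m + 1 : ℕ) + β / 2 * (((m + 1 : ℕ) - 1) * cosSum t)) *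
        regularizedWeight β 0 t = 0 := by
  have hlim := tendsto_integral_filter_of_dominated_convergence
    (μ := volume.restrict (Set.Icc (0 : Fin (m + 1) → ℝ) (fun _ => 2 * Real.pi)))
    (l := 𝓝[>] (0 : ℝ))
    (F := fun ε t => weightedDivergence β ε t * regularizedWeight β ε t)
    (fun t => (|cosSum t - (m + 1 : ℕ)| + β / 2 * ∑ j, ∑ k ∈ Ioi j, |pairTerm t j k|) *
      regularizedWeight β 1 t)
    (by
      filter_upwards [self_mem_nhdsWithin] with ε hε
      exact ((continuous_weightedDivergence β hε).mul
        (continuous_regularizedWeight hβ.le ε)).aestronglyMeasurable)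
    (by
      filter_upwards [Ioc_mem_nhdsGT one_pos] with ε hε
      refine Eventually.of_forall fun t => ?_
      rw [Real.norm_eq_abs, abs_mul, abs_of_nonneg (regularizedWeight_nonneg β hε.1.le t)]
      have h := abs_weightedDivergence_le hβ.le hε.1 t
      exact mul_le_mul h (regularizedWeight_mono hβ.le hε.1.le hε.2 t)
        (regularizedWeight_nonneg β hε.1.le t) ((abs_nonneg _).trans h))
    (by
      refine Continuous.integrableOn_Icc ?_
      refine Continuous.mul ?_ (continuous_regularizedWeight hβ.le 1)
      refine (continuous_cosSum.sub continuous_const).abs.add (continuous_const.mul ?_)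
      exact continuous_finsetSum _ fun j _ => continuous_finsetSum _ fun k _ =>
        (continuous_pairTerm j k).abs)
    (Eventually.of_forall fun t => tendsto_weightedDivergence_mul_weight hβ t)
  refine tendsto_nhds_unique hlim (tendsto_const_nhds.congr' ?_)
  filter_upwards [self_mem_nhdsWithin] with ε hε
  exact (integral_weightedDivergence_mul_weight hβ.le hε).symm

lemma integral_cosSum_mul_weight {n : ℕ} (hn : 1 ≤ n) {β : ℝ} (hβ : 0 < β) :
    (1 + β / 2 * ((n : ℝ) - 1)) * ∫ t in Set.Icc (0 : Fin n → ℝ) (fun _ => 2 * Real.pi),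
        regularizedWeight β 0 t * cosSum t =
      n * ∫ t in Set.Icc (0 : Fin n → ℝ) (fun _ => 2 * Real.pi), regularizedWeight β 0 t := by
  obtain ⟨m, rfl⟩ : ∃ m, n = m + 1 := ⟨n - 1, by omega⟩
  have hw := continuous_regularizedWeight (n := m + 1) hβ.le 0
  have hc := continuous_cosSum (n := m + 1)
  rw [← sub_eq_zero, ← integral_const_mul, ← integral_const_mul, ← integral_sub
    (Continuous.integrableOn_Icc (by fun_prop)) (Continuous.integrableOn_Icc (by fun_prop))]
  refine Eq.trans ?_ (integral_cosSum_mul_weight_aux (m := m) hβ)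
  congr 1
  funext t
  ring

/-! ### Back to the ensemble -/

lemma integral_circularBetaEnsemble {n : ℕ} {β : ℝ} (hβ : 0 < β) (g : (Fin n → ℝ) → ℝ) :
    ∫ t, g t ∂circularBetaEnsemble n β = ((2 * Real.pi) ^ n)⁻¹ *
      (Real.Gamma (1 + β / 2) ^ n / Real.Gamma (1 + β * n / 2)) *
      ∫ t in Set.Icc (0 : Fin n → ℝ) (fun _ => 2 * Real.pi), regularizedWeight β 0 t * g t := by
  have hc : 0 ≤ ((2 * Real.pi) ^ n)⁻¹ *
      (Real.Gamma (1 + β / 2) ^ n / Real.Gamma (1 + β * n / 2)) := by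
    have h₁ : 0 < Real.Gamma (1 + β / 2) := Real.Gamma_pos_of_pos (by positivity)
    have h₂ : 0 < Real.Gamma (1 + β * n / 2) := Real.Gamma_pos_of_pos (by positivity)
    positivity
  have hmeas : Measurable (circularBetaDensity n β) := by
    rw [funext (circularBetaDensity_eq β)]
    exact (continuous_const.mul (continuous_regularizedWeight hβ.le 0)).measurable
  rw [circularBetaEnsemble, integral_withDensity_eq_integral_toReal_smul
    hmeas.ennreal_ofReal (Eventually.of_forall fun _ => ENNReal.ofReal_lt_top),
    ← integral_const_mul]
  have hset : (Set.univ.pi fun _ => Set.Ico (0 : ℝ) (2 * Real.pi)) =ᵐ[volume]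
      Set.Icc (0 : Fin n → ℝ) (fun _ => 2 * Real.pi) := Measure.univ_pi_Ico_ae_eq_Icc
  rw [setIntegral_congr_set hset]
  congr 1
  funext t
  rw [circularBetaDensity_eq, ENNReal.toReal_ofReal
    (mul_nonneg hc (regularizedWeight_nonneg β le_rfl t)), smul_eq_mul, mul_assoc]

lemma integral_cosSum_circularBetaEnsemble {n : ℕ} (hn : 1 ≤ n) {β : ℝ} (hβ : 0 < β)
    [IsProbabilityMeasure (circularBetaEnsemble n β)] :
    (1 + β / 2 * ((n : ℝ) - 1)) * ∫ t, cosSum t ∂circularBetaEnsemble n β = n := by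
  -- Total mass one supplies the normalization, in place of Dyson's integral.
  have h₁ : ∫ _, (1 : ℝ) ∂circularBetaEnsemble n β = 1 := by simp
  rw [integral_circularBetaEnsemble hβ] at h₁
  simp only [mul_one] at h₁
  rw [integral_circularBetaEnsemble hβ, mul_left_comm, integral_cosSum_mul_weight hn hβ,
    mul_left_comm, h₁, mul_one]

theorem mainTheorem5 {Ω : Type*} [MeasurableSpace Ω] (P : Measure Ω) [IsProbabilityMeasure P]
    (n : ℕ) (hn : 1 ≤ n) (β : ℝ) (hβ : 0 < β) (θ : Fin n → Ω → ℝ)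
    (hθ : HasLaw (fun ω j => θ j ω) (circularBetaEnsemble n β) P) :
    (∫ ω, ‖powerSum 1 (torusPoint fun j => θ j ω)‖ ^ 2 ∂P
        = 2 / β * ((n : ℝ) / ((n : ℝ) - 1 + 2 / β))) ∧
      (β = 1 → ∫ ω, ‖powerSum 1 (torusPoint fun j => θ j ω)‖ ^ 2 ∂P
        = 2 * (n : ℝ) / ((n : ℝ) + 1)) ∧
      (β = 2 → ∫ ω, ‖powerSum 1 (torusPoint fun j => θ j ω)‖ ^ 2 ∂P = 1) ∧
      (β = 4 → ∫ ω, ‖powerSum 1 (torusPoint fun j => θ j ω)‖ ^ 2 ∂P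
        = (n : ℝ) / (2 * (n : ℝ) - 1)) := by
  have hprob : IsProbabilityMeasure (circularBetaEnsemble n β) :=
    hθ.isProbabilityMeasure_iff.1 inferInstance
  have hE : ∫ ω, ‖powerSum 1 (torusPoint fun j => θ j ω)‖ ^ 2 ∂P
      = 2 / β * ((n : ℝ) / ((n : ℝ) - 1 + 2 / β)) := by
    have h := integral_cosSum_circularBetaEnsemble hn hβ
    rw [← hθ.integral_comp continuous_cosSum.aestronglyMeasurable] at h
    simp only [norm_sq_powerSum_one]
    have hn' : (0 : ℝ) ≤ (n : ℝ) - 1 := sub_nonneg.2 (by exact_mod_cast hn)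
    have hpos' : 0 < (n : ℝ) - 1 + 2 / β := by positivity
    have hfac : (n : ℝ) - 1 + 2 / β = 2 / β * (1 + β / 2 * ((n : ℝ) - 1)) := by
      field_simp
      ring
    simp only [Function.comp_def] at h
    rw [← mul_div_assoc, eq_div_iff hpos'.ne', hfac]
    linear_combination 2 / β * h
  have hn' : (1 : ℝ) ≤ n := by exact_mod_cast hn
  refine ⟨hE, ?_, ?_, ?_⟩ <;> rintro rfl <;> rw [hE]
  · rw [show (n : ℝ) - 1 + 2 / 1 = n + 1 by ring]
    ring
  · rw [show (n : ℝ) - 1 + 2 / 2 = n by ring, div_self (zero_lt_one.trans_le hn').ne']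
    norm_num
  · rw [show (n : ℝ) - 1 + 2 / 4 = (2 * n - 1) / 2 by ring]
    field_simp
    ring
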